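/- **Theorem (strong coreset via Bernstein inequality).** Let $p_1,\dots,p_n\in\mathbb{R}^d$ and $w_1,\dots,w_n>0$ form a normalized weighted set, that is, $$\sum_{i=1}^n w_i=1,\qquad \sum_{i=1}^n w_ip_i=0,\qquad \sum_{i=1}^n w_i\|p_i\|^2=1 ,$$ where $\|\cdot\|$ is the Euclidean norm. Let $\varepsilon,\delta\in(0,1)$, put $$K=\frac{4\log\left((d+1)/\delta\right)}{\varepsilon^2},$$ and let $k$ be $K$ rounded to an integer, either down or up ($k=\lfloor K\rfloor$ or $k=\lceil K\rceil$). Draw $k$ indices from $\{1,\dots,n\}$ independently, each equal to $i$ with probability $$s_i=\frac{w_i(\|p_i\|^2+1)}{\sum_{j=1}^n w_j(\|p_j\|^2+1)},$$ let $c_i$ be the number of times that the index $i$ is drawn, and put $$u_i=\frac{2c_i}{k(\|p_i\|^2+1)}\qquad(i=1,\dots,n).$$ Then $u=(u_1,\dots,u_n)$ always has at most $k$ non-zero entries, and $(P,u)$ is a strong mean $(2\varepsilon,\delta)$-coreset for $(P,w)$: with probability at least $1-\delta$, simultaneously for all $x\in\mathbb{R}^d$, $$\left|\sum_{i=1}^n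 w_i\|p_i-x\|^2-\sum_{i=1}^n u_i\|p_i-x\|^2\right|\le 2\varepsilon\sum_{i=1}^n w_i\|p_i-x\|^2 .$$ -/

import Mathlib

open MeasureTheory ProbabilityTheory

noncomputable section

namespace MeanCoreset

/-- A normalized weighted set: points `p₁, …, pₙ` in `ℝᵈ` with positive weights that sum to one,
whose weighted sum is the origin and whose weighted sum of squared norms is one. -/
structure IsNormalizedWeightedSet {d n : ℕ} (p : Fin n → EuclideanSpace ℝ (Fin d))
    (w : Fin n → ℝ) : Prop where
  weight_pos : ∀ i, 0 < w i
  sum_weight : ∑ i, w i = 1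
  weighted_sum : ∑ i, w i • p i = 0
  weighted_sq_norm : ∑ i, w i * ‖p i‖ ^ 2 = 1

/-- The cost `∑ᵢ vᵢ ‖pᵢ - x‖²` of the query `x` on the points `p` with weights `v`. -/
def cost {d n : ℕ} (p : Fin n → EuclideanSpace ℝ (Fin d)) (v : Fin n → ℝ)
    (x : EuclideanSpace ℝ (Fin d)) : ℝ :=
  ∑ i, v i * ‖p i - x‖ ^ 2

/-- The random weights `u` give a strong mean `(ε, δ)`-coreset `(p, u)` for `(p, w)`:
with probability at least `1 - δ`, simultaneously for all queries `x`, the cost of `x` is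
preserved up to relative error `ε`. -/
def IsStrongMeanCoreset {d n : ℕ} {Ω : Type*} [MeasurableSpace Ω] (μ : Measure Ω)
    (p : Fin n → EuclideanSpace ℝ (Fin d)) (w : Fin n → ℝ) (u : Ω → Fin n → ℝ)
    (ε δ : ℝ) : Prop :=
  1 - δ ≤ μ.real {ω | ∀ x : EuclideanSpace ℝ (Fin d),
    |cost p w x - cost p (u ω) x| ≤ ε * cost p w x}

/-- `‖v‖₀`, the number of non-zero entries. -/
def nnz {n : ℕ} (v : Fin n → ℝ) : ℕ :=
  {i | v i ≠ 0}.ncard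

/-- `‖(q ∣ 1)‖²`, the squared norm of the vector `q` extended by a last coordinate `1`. -/
def liftSq {d : ℕ} (q : EuclideanSpace ℝ (Fin d)) : ℝ :=
  ‖q‖ ^ 2 + 1

/-- The probability `sᵢ` with which the algorithm samples the `i`-th point. -/
def sampleProb {d n : ℕ} (p : Fin n → EuclideanSpace ℝ (Fin d)) (w : Fin n → ℝ)
    (i : Fin n) : ℝ :=
  w i * liftSq (p i) / ∑ j, w j * liftSq (p j)

/-- The (real) sample size `4 log((d+1)/δ) / ε` that the algorithm prescribes when it is called
in dimension `d` with error parameter `ε` and failure probability `δ`. -/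
def sampleSize (d : ℕ) (ε δ : ℝ) : ℝ :=
  4 * Real.log ((d + 1) / δ) / ε

/-- `S₁, …, Sₖ` are random indices, independent and identically distributed with
`Pr(Sⱼ = i) = sᵢ`. -/
structure IsIIDSample {d n k : ℕ} {Ω : Type*} [MeasurableSpace Ω] (μ : Measure Ω)
    (p : Fin n → EuclideanSpace ℝ (Fin d)) (w : Fin n → ℝ) (S : Fin k → Ω → Fin n) : Prop where
  measurable : ∀ j, Measurable (S j)
  indep : iIndepFun S μ
  law : ∀ j i, μ.real {ω | S j ω = i} = sampleProb p w i

/-- `cᵢ`, the number of times that the index `i` occurs in the sample `s`. -/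
def sampleCount {n k : ℕ} (s : Fin k → Fin n) (i : Fin n) : ℕ :=
  {j | s j = i}.ncard

/-- The output weights `uᵢ = 2 cᵢ / (k ‖(pᵢ ∣ 1)‖²)` that the algorithm computes from the drawn
sample `s` of size `k`. -/
def coresetWeight {d n k : ℕ} (p : Fin n → EuclideanSpace ℝ (Fin d)) (s : Fin k → Fin n)
    (i : Fin n) : ℝ :=
  2 * (sampleCount s i : ℝ) / (k * liftSq (p i))

end MeanCoreset

end

/-!
The points are lifted to `ℝᵈ⁺¹` and inverted: put `Lᵢ = ‖pᵢ‖² + 1` and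
`Xᵢ = (2 / Lᵢ) (pᵢ, 1) - (0, 1)`. Since `(0, 1)` has length one, each `Xᵢ` is a unit vector, and
`∑ sᵢ Xᵢ = 0` because `sᵢ = wᵢ Lᵢ / 2`, the weights sum to one and the points are centred.
The normalization gives `cost p w x = 1 + ‖x‖²`, and for the weights `u` of a sample `s` of size `k`
`cost p u x - cost p w x = ⟪k⁻¹ ∑ⱼ X (s j), (-2x, ‖x‖² - 1)⟫`, where the second vector has norm
`1 + ‖x‖²` (`norm_queryVector`). By the Cauchy–Schwarz inequality, the coreset property for *all*
queries with relative error `2ε` follows from the single event `‖∑ⱼ X (s j)‖ ≤ 2εk`.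

That event is a deviation bound for a sum of independent centred unit vectors, so a Hoeffding
inequality in a Hilbert space (Pinelis) takes the place of a matrix Bernstein inequality.
Its core is that `v ↦ cosh √v` is convex on `[0, ∞)`: bounding it by its chord
between `(‖a‖ - R)²` and `(‖a‖ + R)²` gives `𝔼 cosh ‖a + X‖ ≤ cosh ‖a‖ * cosh R` for a centred `X`
with `‖X‖ ≤ R` (`sum_mul_cosh_norm_add_le`). Iterating over the sample and applying Markov's
inequality bounds the failure probability by `2 exp (-2kε²)`, and this is at most `δ` for both
roundings of the sample size, because `(d + 1) / δ ≥ 2`.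
-/

namespace MeanCoreset

open scoped RealInnerProductSpace

/-! ### Convexity of `cosh √v` -/

theorem hasSum_cosh_sqrt {v : ℝ} (hv : 0 ≤ v) :
    HasSum (fun m : ℕ => v ^ m / (2 * m).factorial) (Real.cosh √v) := by
  have h := Real.hasSum_cosh √v
  simpa only [pow_mul, Real.sq_sqrt hv] using h

/-- All coefficients of the power series `∑ vᵐ / (2m)!` of `cosh √v` are nonnegative. -/
theorem convexOn_cosh_sqrt : ConvexOn ℝ (Set.Ici 0) fun v : ℝ => Real.cosh √v := by
  refine ⟨convex_Ici 0, fun x hx y hy a b ha hb hab => ?_⟩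
  have hx' : 0 ≤ x := hx
  have hy' : 0 ≤ y := hy
  have hxy : 0 ≤ a • x + b • y := by simp only [smul_eq_mul]; positivity
  refine hasSum_le (fun m => ?_) (hasSum_cosh_sqrt hxy)
    (((hasSum_cosh_sqrt hx').mul_left a).add ((hasSum_cosh_sqrt hy').mul_left b))
  have h := (convexOn_pow (𝕜 := ℝ) m).2 hx hy ha hb hab
  simp only [smul_eq_mul] at h ⊢
  rw [← mul_div_assoc, ← mul_div_assoc, ← add_div]
  gcongr

/-- The chord bound for `cosh √v` between `v = (a - b)²` and `v = (a + b)²`. Its slope in `c` does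
not depend on `c`, so that it averages out when `c` has mean zero. -/
theorem cosh_sqrt_le_chord {a b c : ℝ} (ha : 0 ≤ a) (hb : 0 ≤ b) (hc : |c| ≤ a * b) :
    Real.cosh √(a ^ 2 + b ^ 2 + 2 * c) ≤
      Real.cosh a * Real.cosh b + c * (Real.sinh a * Real.sinh b / (a * b)) := by
  rcases ha.eq_or_lt with rfl | ha
  · have : c = 0 := by simpa using hc
    simp [this, Real.sqrt_sq hb]
  rcases hb.eq_or_lt with rfl | hb
  · have : c = 0 := by simpa using hc
    simp [this, Real.sqrt_sq ha.le]
  obtain ⟨h₁, h₂⟩ := abs_le.1 hc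
  have hab : 0 < a * b := mul_pos ha hb
  have hα : 0 ≤ (a * b + c) / (2 * (a * b)) := div_nonneg (by linarith) (by positivity)
  have hβ : 0 ≤ (a * b - c) / (2 * (a * b)) := div_nonneg (by linarith) (by positivity)
  have h := convexOn_cosh_sqrt.2 (Set.mem_Ici.2 (sq_nonneg (a + b)))
    (Set.mem_Ici.2 (sq_nonneg (a - b))) hα hβ (by field_simp; ring)
  simp only [smul_eq_mul, Real.sqrt_sq_eq_abs, Real.cosh_abs] at h
  rw [Real.cosh_add, Real.cosh_sub] at h
  have harg : a ^ 2 + b ^ 2 + 2 * c = (a * b + c) / (2 * (a * b)) * (a + b) ^ 2 +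
      (a * b - c) / (2 * (a * b)) * (a - b) ^ 2 := by
    field_simp
    ring
  rw [harg]
  refine h.trans_eq ?_
  field_simp
  ring

/-! ### A Hoeffding inequality for sums of independent vectors -/

section Hoeffding

variable {ι E : Type*} [Fintype ι] [NormedAddCommGroup E] [InnerProductSpace ℝ E]

/-- One step of Pinelis' argument: adding an independent centred vector of norm at most `R`
increases the expectation of `cosh ‖·‖` by a factor of at most `cosh R`. -/
theorem sum_mul_cosh_norm_add_le {q : ι → ℝ} {X : ι → E} {R : ℝ} (hq : ∀ i, 0 ≤ q i)
    (hq1 : ∑ i, q i = 1) (hX0 : ∑ i, q i • X i = 0) (hR : 0 ≤ R) (hX : ∀ i, ‖X i‖ ≤ R) (a : E) :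
    ∑ i, q i * Real.cosh ‖a + X i‖ ≤ Real.cosh ‖a‖ * Real.cosh R := by
  set κ := Real.sinh ‖a‖ * Real.sinh R / (‖a‖ * R)
  have key : ∀ i, Real.cosh ‖a + X i‖ ≤ Real.cosh ‖a‖ * Real.cosh R + ⟪a, X i⟫ * κ := fun i => by
    refine le_trans ?_ (cosh_sqrt_le_chord (norm_nonneg a) hR
      ((abs_real_inner_le_norm a (X i)).trans (by gcongr; exact hX i)))
    rw [Real.cosh_le_cosh, abs_of_nonneg (norm_nonneg _), abs_of_nonneg (Real.sqrt_nonneg _)]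
    refine Real.le_sqrt_of_sq_le ?_
    rw [norm_add_sq_real]
    have : ‖X i‖ ^ 2 ≤ R ^ 2 := by gcongr; exact hX i
    linarith
  have hinner : ∑ i, q i * ⟪a, X i⟫ = 0 := by
    simp_rw [← real_inner_smul_right, ← inner_sum, hX0, inner_zero_right]
  calc ∑ i, q i * Real.cosh ‖a + X i‖
      ≤ ∑ i, q i * (Real.cosh ‖a‖ * Real.cosh R + ⟪a, X i⟫ * κ) := by
        gcongr with i; exacts [hq i, key i]
    _ = (∑ i, q i) * (Real.cosh ‖a‖ * Real.cosh R) + (∑ i, q i * ⟪a, X i⟫) * κ := by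
        simp_rw [Finset.sum_mul, ← Finset.sum_add_distrib]
        exact Finset.sum_congr rfl fun i _ => by ring
    _ = Real.cosh ‖a‖ * Real.cosh R := by rw [hq1, hinner]; ring

theorem sum_prod_mul_cosh_norm_add_sum_le {q : ι → ℝ} {X : ι → E} {R : ℝ} (hq : ∀ i, 0 ≤ q i)
    (hq1 : ∑ i, q i = 1) (hX0 : ∑ i, q i • X i = 0) (hR : 0 ≤ R) (hX : ∀ i, ‖X i‖ ≤ R)
    (k : ℕ) (a : E) :
    ∑ s : Fin k → ι, (∏ j, q (s j)) * Real.cosh ‖a + ∑ j, X (s j)‖ ≤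
      Real.cosh ‖a‖ * Real.cosh R ^ k := by
  induction k generalizing a with
  | zero => simp
  | succ k ih =>
    rw [← (Fin.consEquiv fun _ : Fin (k + 1) => ι).sum_comp, Fintype.sum_prod_type]
    simp only [Fin.consEquiv_apply, Fin.prod_univ_succ, Fin.sum_univ_succ, Fin.cons_zero,
      Fin.cons_succ, mul_assoc, ← Finset.mul_sum, ← add_assoc]
    calc ∑ i, q i * ∑ s : Fin k → ι, (∏ j, q (s j)) * Real.cosh ‖a + X i + ∑ j, X (s j)‖
        ≤ ∑ i, q i * (Real.cosh ‖a + X i‖ * Real.cosh R ^ k) := by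
          gcongr with i; exacts [hq i, ih (a + X i)]
      _ = (∑ i, q i * Real.cosh ‖a + X i‖) * Real.cosh R ^ k := by
          simp_rw [Finset.sum_mul, mul_assoc]
      _ ≤ (Real.cosh ‖a‖ * Real.cosh R) * Real.cosh R ^ k := by
          gcongr; exact sum_mul_cosh_norm_add_le hq hq1 hX0 hR hX a
      _ = Real.cosh ‖a‖ * Real.cosh R ^ (k + 1) := by ring

/-- Hoeffding's inequality for `k` independent centred vectors in the unit ball, with the sample
space `Fin k → ι` and the product weights `∏ j, q (s j)`. -/
theorem sum_prod_norm_sum_gt_le {q : ι → ℝ} {X : ι → E} (hq : ∀ i, 0 ≤ q i)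
    (hq1 : ∑ i, q i = 1) (hX0 : ∑ i, q i • X i = 0) (hX : ∀ i, ‖X i‖ ≤ 1) (k : ℕ) {r : ℝ}
    (hr : 0 ≤ r) (B : Finset (Fin k → ι)) (hB : ∀ s ∈ B, r * k < ‖∑ j, X (s j)‖) :
    ∑ s ∈ B, ∏ j, q (s j) ≤ 2 * Real.exp (-(k * r ^ 2 / 2)) := by
  have hprod : ∀ s : Fin k → ι, 0 ≤ ∏ j, q (s j) := fun s => Finset.prod_nonneg fun j _ => hq _
  -- the exponential moment at the optimal parameter `λ = r`, that is, for the vectors `r • X i`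
  have hmoment := sum_prod_mul_cosh_norm_add_sum_le (X := fun i => r • X i) (R := r) hq hq1
    (by simp_rw [smul_comm _ r, ← Finset.smul_sum, hX0, smul_zero]) hr
    (fun i => by
      rw [norm_smul, Real.norm_of_nonneg hr]
      exact mul_le_of_le_one_right hr (hX i)) k 0
  simp only [zero_add, norm_zero, Real.cosh_zero, one_mul, ← Finset.smul_sum, norm_smul,
    Real.norm_of_nonneg hr] at hmoment
  have hmarkov : (∑ s ∈ B, ∏ j, q (s j)) * Real.cosh (k * r ^ 2) ≤ Real.exp (k * r ^ 2 / 2) :=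
    calc (∑ s ∈ B, ∏ j, q (s j)) * Real.cosh (k * r ^ 2)
        ≤ ∑ s ∈ B, (∏ j, q (s j)) * Real.cosh (r * ‖∑ j, X (s j)‖) := by
          rw [Finset.sum_mul]
          refine Finset.sum_le_sum fun s hs => mul_le_mul_of_nonneg_left ?_ (hprod s)
          rw [Real.cosh_le_cosh, abs_of_nonneg (by positivity), abs_of_nonneg (by positivity)]
          calc k * r ^ 2 = r * (r * k) := by ring
            _ ≤ r * ‖∑ j, X (s j)‖ := mul_le_mul_of_nonneg_left (hB s hs).le hr
      _ ≤ ∑ s : Fin k → ι, (∏ j, q (s j)) * Real.cosh (r * ‖∑ j, X (s j)‖) :=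
          Finset.sum_le_univ_sum_of_nonneg fun s =>
            mul_nonneg (hprod s) (Real.cosh_pos _).le
      _ ≤ Real.cosh r ^ k := hmoment
      _ ≤ Real.exp (r ^ 2 / 2) ^ k := by
          gcongr
          exact Real.cosh_le_exp_half_sq r
      _ = Real.exp (k * r ^ 2 / 2) := by rw [← Real.exp_nat_mul]; ring_nf
  have hcosh : Real.exp (k * r ^ 2 / 2) * Real.exp (k * r ^ 2 / 2) ≤
      2 * Real.cosh (k * r ^ 2) := by
    rw [← Real.exp_add, add_halves, Real.cosh_eq]
    linarith [Real.exp_pos (-(k * r ^ 2))]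
  have hsum : 0 ≤ ∑ s ∈ B, ∏ j, q (s j) := Finset.sum_nonneg fun s _ => hprod s
  generalize ∑ s ∈ B, ∏ j, q (s j) = P at hmarkov hsum ⊢
  rw [Real.exp_neg, ← div_eq_mul_inv, le_div_iff₀ (Real.exp_pos _)]
  refine le_of_mul_le_mul_right ?_ (Real.exp_pos (k * r ^ 2 / 2))
  rw [mul_assoc]
  linarith [mul_le_mul_of_nonneg_left hcosh hsum]

end Hoeffding

/-! ### The lifted points -/

section Lift

variable {d n : ℕ}

theorem liftSq_pos (q : EuclideanSpace ℝ (Fin d)) : 0 < liftSq q := by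
  unfold liftSq; positivity

/-- The vector `(2 / ‖(q ∣ 1)‖²) (q, 1) - (0, 1)`: the image of the lifted point `(q, 1)`
under the inversion in the sphere of radius `√2`, moved so that the unit sphere onto which this
inversion maps the hyperplane of lifted points has its centre at the origin. -/
noncomputable def invLift (q : EuclideanSpace ℝ (Fin d)) :
    WithLp 2 (EuclideanSpace ℝ (Fin d) × ℝ) :=
  WithLp.toLp 2 ((2 / liftSq q) • q, 2 / liftSq q - 1)

/-- The vector `(-2x, ‖x‖² - 1)` whose inner product with `invLift q` is the scaled squared
distance `2 ‖q - x‖² / ‖(q ∣ 1)‖²` minus the cost `1 + ‖x‖²` of `x`. -/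
noncomputable def queryVector (x : EuclideanSpace ℝ (Fin d)) :
    WithLp 2 (EuclideanSpace ℝ (Fin d) × ℝ) :=
  WithLp.toLp 2 ((-2 : ℝ) • x, ‖x‖ ^ 2 - 1)

theorem norm_invLift (q : EuclideanSpace ℝ (Fin d)) : ‖invLift q‖ = 1 := by
  have hL := liftSq_pos q
  have hq : ‖q‖ ^ 2 = liftSq q - 1 := by simp [liftSq]
  rw [← sq_eq_sq₀ (norm_nonneg _) zero_le_one, WithLp.prod_norm_sq_eq_of_L2]
  simp only [invLift, WithLp.toLp_fst, WithLp.toLp_snd, norm_smul, mul_pow, hq,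
    Real.norm_eq_abs, sq_abs]
  field_simp
  ring

theorem norm_queryVector (x : EuclideanSpace ℝ (Fin d)) : ‖queryVector x‖ = 1 + ‖x‖ ^ 2 := by
  rw [← sq_eq_sq₀ (norm_nonneg _) (by positivity), WithLp.prod_norm_sq_eq_of_L2]
  simp only [queryVector, WithLp.toLp_fst, WithLp.toLp_snd, norm_smul, mul_pow,
    Real.norm_eq_abs, sq_abs]
  ring

theorem two_div_liftSq_mul_norm_sub_sq (q x : EuclideanSpace ℝ (Fin d)) :
    2 / liftSq q * ‖q - x‖ ^ 2 = 1 + ‖x‖ ^ 2 + ⟪invLift q, queryVector x⟫ := by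
  have hL := liftSq_pos q
  have hq : ‖q‖ ^ 2 = liftSq q - 1 := by simp [liftSq]
  rw [WithLp.prod_inner_apply, norm_sub_sq_real, hq]
  simp only [invLift, queryVector, real_inner_smul_left, real_inner_smul_right, RCLike.inner_apply,
    conj_trivial]
  field_simp
  ring

variable {p : Fin n → EuclideanSpace ℝ (Fin d)} {w : Fin n → ℝ}

theorem IsNormalizedWeightedSet.sum_mul_liftSq (h : IsNormalizedWeightedSet p w) :
    ∑ i, w i * liftSq (p i) = 2 := by
  simp only [liftSq, mul_add, mul_one, Finset.sum_add_distrib, h.weighted_sq_norm, h.sum_weight]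
  norm_num

theorem IsNormalizedWeightedSet.cost_eq (h : IsNormalizedWeightedSet p w)
    (x : EuclideanSpace ℝ (Fin d)) : cost p w x = 1 + ‖x‖ ^ 2 := by
  have hinner : ∑ i, w i * ⟪p i, x⟫ = 0 := by
    simp_rw [← real_inner_smul_left, ← sum_inner, h.weighted_sum, inner_zero_left]
  calc cost p w x
      = ∑ i, w i * ‖p i‖ ^ 2 - 2 * ∑ i, w i * ⟪p i, x⟫ + (∑ i, w i) * ‖x‖ ^ 2 := by
        rw [cost, Finset.mul_sum, Finset.sum_mul, ← Finset.sum_sub_distrib,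
          ← Finset.sum_add_distrib]
        exact Finset.sum_congr rfl fun i _ => by rw [norm_sub_sq_real]; ring
    _ = 1 + ‖x‖ ^ 2 := by rw [h.weighted_sq_norm, hinner, h.sum_weight]; ring

theorem IsNormalizedWeightedSet.dim_pos (h : IsNormalizedWeightedSet p w) : 0 < d := by
  rcases Nat.eq_zero_or_pos d with rfl | hd
  · have := h.weighted_sq_norm
    simp [Subsingleton.elim _ (0 : EuclideanSpace ℝ (Fin 0))] at this
  · exact hd

theorem IsNormalizedWeightedSet.sampleProb_nonneg (h : IsNormalizedWeightedSet p w) (i : Fin n) :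
    0 ≤ sampleProb p w i := by
  rw [sampleProb, h.sum_mul_liftSq]
  have := h.weight_pos i
  have := liftSq_pos (p i)
  positivity

theorem IsNormalizedWeightedSet.sum_sampleProb (h : IsNormalizedWeightedSet p w) :
    ∑ i, sampleProb p w i = 1 := by
  simp only [sampleProb]
  rw [← Finset.sum_div, h.sum_mul_liftSq, div_self two_ne_zero]

theorem IsNormalizedWeightedSet.sum_sampleProb_smul_invLift (h : IsNormalizedWeightedSet p w) :
    ∑ i, sampleProb p w i • invLift (p i) = 0 := by
  have hs : ∀ i, sampleProb p w i * (2 / liftSq (p i)) = w i := fun i => by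
    have := liftSq_pos (p i)
    rw [sampleProb, h.sum_mul_liftSq]
    field_simp
  have h₁ : ∑ i, sampleProb p w i • (2 / liftSq (p i)) • p i = 0 := by
    simp_rw [smul_smul, hs, h.weighted_sum]
  have h₂ : ∑ i, sampleProb p w i * (2 / liftSq (p i) - 1) = 0 := by
    simp_rw [mul_sub, hs, mul_one, Finset.sum_sub_distrib, h.sum_weight, h.sum_sampleProb, sub_self]
  refine WithLp.ofLp_injective 2 (Prod.ext ?_ ?_)
  · rw [WithLp.ofLp_sum, Prod.fst_sum]
    exact h₁
  · rw [WithLp.ofLp_sum, Prod.snd_sum]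
    exact h₂

end Lift

/-! ### The cost of a sample -/

section Sample

variable {d n k : ℕ} {p : Fin n → EuclideanSpace ℝ (Fin d)} {w : Fin n → ℝ}

theorem nnz_coresetWeight_le (p : Fin n → EuclideanSpace ℝ (Fin d)) (s : Fin k → Fin n) :
    nnz (coresetWeight p s) ≤ k := by
  have hsub : {i | coresetWeight p s i ≠ 0} ⊆ Set.range s := fun i hi => by
    by_contra hnot
    refine hi ?_
    have : {j | s j = i} = ∅ := Set.eq_empty_of_forall_notMem fun j hj => hnot ⟨j, hj⟩
    simp [coresetWeight, sampleCount, this]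
  calc nnz (coresetWeight p s) ≤ (Set.range s).ncard := Set.ncard_le_ncard hsub
    _ ≤ (Set.univ : Set (Fin k)).ncard := by
      rw [← Set.image_univ]; exact Set.ncard_image_le
    _ = k := by simp

theorem sum_sampleCount_mul (s : Fin k → Fin n) (f : Fin n → ℝ) :
    ∑ i, (sampleCount s i : ℝ) * f i = ∑ j, f (s j) := by
  rw [← Finset.sum_fiberwise Finset.univ s fun j => f (s j)]
  refine Finset.sum_congr rfl fun i _ => ?_
  rw [Finset.sum_congr rfl (g := fun _ => f i) fun j hj => by rw [(Finset.mem_filter.1 hj).2],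
    Finset.sum_const, nsmul_eq_mul, sampleCount, ← Set.ncard_coe_finset]
  simp

theorem cost_coresetWeight (hk : 0 < k) (s : Fin k → Fin n) (x : EuclideanSpace ℝ (Fin d)) :
    cost p (coresetWeight p s) x =
      1 + ‖x‖ ^ 2 + (k : ℝ)⁻¹ * ⟪∑ j, invLift (p (s j)), queryVector x⟫ := by
  have hk' : (k : ℝ) ≠ 0 := by positivity
  calc cost p (coresetWeight p s) x
      = ∑ i, (sampleCount s i : ℝ) * ((k : ℝ)⁻¹ * (2 / liftSq (p i) * ‖p i - x‖ ^ 2)) :=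
        Finset.sum_congr rfl fun i _ => by
          have := liftSq_pos (p i)
          rw [coresetWeight]
          field_simp
    _ = ∑ j, (k : ℝ)⁻¹ * (1 + ‖x‖ ^ 2 + ⟪invLift (p (s j)), queryVector x⟫) := by
        simp_rw [two_div_liftSq_mul_norm_sub_sq]
        exact sum_sampleCount_mul s _
    _ = _ := by
        rw [← Finset.mul_sum, Finset.sum_add_distrib, sum_inner, Finset.sum_const,
          Finset.card_univ, Fintype.card_fin, nsmul_eq_mul]
        field_simp

/-- A bound on the norm of one vector controls the relative error for all queries at once. -/
theorem IsNormalizedWeightedSet.abs_cost_sub_cost_le (h : IsNormalizedWeightedSet p w)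
    (hk : 0 < k) (s : Fin k → Fin n) {r : ℝ} (hs : ‖∑ j, invLift (p (s j))‖ ≤ r * k)
    (x : EuclideanSpace ℝ (Fin d)) :
    |cost p w x - cost p (coresetWeight p s) x| ≤ r * cost p w x := by
  have hk' : (0 : ℝ) < k := by exact_mod_cast hk
  rw [cost_coresetWeight hk, h.cost_eq, sub_add_cancel_left, abs_neg, abs_mul,
    abs_of_pos (inv_pos.2 hk')]
  calc (k : ℝ)⁻¹ * |⟪∑ j, invLift (p (s j)), queryVector x⟫|
      ≤ (k : ℝ)⁻¹ * (r * k * (1 + ‖x‖ ^ 2)) := by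
        rw [← norm_queryVector]
        gcongr
        exact (abs_real_inner_le_norm _ _).trans (by gcongr)
    _ = r * (1 + ‖x‖ ^ 2) := by field_simp

theorem IsIIDSample.measureReal_eq {Ω : Type*} [MeasurableSpace Ω] {μ : Measure Ω}
    {S : Fin k → Ω → Fin n} (hS : IsIIDSample μ p w S) (s : Fin k → Fin n) :
    μ.real {ω | (fun j => S j ω) = s} = ∏ j, sampleProb p w (s j) := by
  have h := hS.indep.measure_inter_preimage_eq_mul Finset.univ (sets := fun j => {s j})
    fun j _ => MeasurableSet.of_discrete
  have hset : {ω | (fun j => S j ω) = s} = ⋂ j ∈ Finset.univ, S j ⁻¹' {s j} := by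
    ext ω; simp [funext_iff]
  rw [hset, measureReal_def, h, ENNReal.toReal_prod]
  exact Finset.prod_congr rfl fun j _ => hS.law j (s j)

/-- Both roundings of the sample size leave at least `4 log ((d + 1) / δ) / ε² - 1` draws, and the
loss of one draw does not matter because `log ((d + 1) / δ) ≥ log 2` for `d ≥ 1`. -/
theorem two_mul_exp_le_of_sampleSize {ε δ : ℝ} (hd : 0 < d) (hε : ε ∈ Set.Ioo (0 : ℝ) 1)
    (hδ : δ ∈ Set.Ioo (0 : ℝ) 1)
    (hk : k = ⌊sampleSize d (ε ^ 2) δ⌋₊ ∨ k = ⌈sampleSize d (ε ^ 2) δ⌉₊) :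
    0 < k ∧ 2 * Real.exp (-(k * (2 * ε) ^ 2 / 2)) ≤ δ := by
  obtain ⟨hε0, hε1⟩ := hε
  obtain ⟨hδ0, hδ1⟩ := hδ
  set L := Real.log ((d + 1) / δ) with hL
  have hd' : (2 : ℝ) ≤ d + 1 := by
    have : (1 : ℝ) ≤ d := by exact_mod_cast hd
    linarith
  have hε2 : 0 < ε ^ 2 := by positivity
  have hε2' : ε ^ 2 < 1 := by nlinarith
  have hL2 : 0.69 < L := by
    refine lt_of_lt_of_le (by linarith [Real.log_two_gt_d9]) (Real.log_le_log two_pos ?_)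
    rw [le_div_iff₀ hδ0]
    nlinarith
  have hkK : sampleSize d (ε ^ 2) δ - 1 ≤ k := by
    rcases hk with hk | hk <;> rw [hk]
    · exact (Nat.sub_one_lt_floor _).le
    · linarith [Nat.le_ceil (sampleSize d (ε ^ 2) δ)]
  have hkε : 4 * L - 1 ≤ k * ε ^ 2 := by
    have hK : sampleSize d (ε ^ 2) δ * ε ^ 2 = 4 * L := by
      rw [sampleSize, ← hL]; field_simp
    nlinarith
  constructor
  · rcases Nat.eq_zero_or_pos k with rfl | h
    · norm_num at hkε; linarith
    · exact h
  · have hexp : Real.exp (-L) = δ / (d + 1) := by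
      rw [Real.exp_neg, hL, Real.exp_log (by positivity), inv_div]
    -- `2kε² ≥ 8L - 2 ≥ L` as `L ≥ 2 / 7`
    calc 2 * Real.exp (-(k * (2 * ε) ^ 2 / 2)) ≤ 2 * Real.exp (-L) := by
          gcongr; nlinarith
      _ = 2 / (d + 1) * δ := by rw [hexp]; ring
      _ ≤ δ := mul_le_of_le_one_left hδ0.le ((div_le_one (by positivity)).2 hd')

end Sample

end MeanCoreset

theorem mainTheorem4 {d n : ℕ} (p : Fin n → EuclideanSpace ℝ (Fin d)) (w : Fin n → ℝ)
    (hpw : MeanCoreset.IsNormalizedWeightedSet p w)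
    (ε δ : ℝ) (hε : ε ∈ Set.Ioo (0 : ℝ) 1) (hδ : δ ∈ Set.Ioo (0 : ℝ) 1)
    (k : ℕ)
    (hk : k = ⌊MeanCoreset.sampleSize d (ε ^ 2) δ⌋₊ ∨ k = ⌈MeanCoreset.sampleSize d (ε ^ 2) δ⌉₊)
    {Ω : Type*} [MeasurableSpace Ω] (μ : Measure Ω) [IsProbabilityMeasure μ]
    (S : Fin k → Ω → Fin n) (hS : MeanCoreset.IsIIDSample μ p w S) :
    (∀ ω, MeanCoreset.nnz (MeanCoreset.coresetWeight p (fun j => S j ω)) ≤ k) ∧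
      MeanCoreset.IsStrongMeanCoreset μ p w
        (fun ω => MeanCoreset.coresetWeight p (fun j => S j ω)) (2 * ε) δ := by
  classical
  refine ⟨fun ω => MeanCoreset.nnz_coresetWeight_le p _, ?_⟩
  obtain ⟨hk0, hkδ⟩ := MeanCoreset.two_mul_exp_le_of_sampleSize hpw.dim_pos hε hδ hk
  set bad : Finset (Fin k → Fin n) := Finset.univ.filter fun s =>
    2 * ε * k < ‖∑ j, MeanCoreset.invLift (p (s j))‖ with hbad
  have hmeas : MeasurableSet {ω | (fun j => S j ω) ∈ bad} :=
    measurable_pi_lambda _ hS.measurable MeasurableSet.of_discrete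
  have hprob : μ.real {ω | (fun j => S j ω) ∈ bad} ≤ δ := by
    have hunion : {ω | (fun j => S j ω) ∈ bad} = ⋃ s ∈ bad, {ω | (fun j => S j ω) = s} := by
      ext ω; simp
    calc μ.real {ω | (fun j => S j ω) ∈ bad}
        ≤ ∑ s ∈ bad, μ.real {ω | (fun j => S j ω) = s} := by
          rw [hunion]; exact measureReal_biUnion_finset_le _ _
      _ = ∑ s ∈ bad, ∏ j, MeanCoreset.sampleProb p w (s j) :=
          Finset.sum_congr rfl fun s _ => hS.measureReal_eq s
      _ ≤ 2 * Real.exp (-(k * (2 * ε) ^ 2 / 2)) :=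
          MeanCoreset.sum_prod_norm_sum_gt_le (X := fun i => MeanCoreset.invLift (p i))
            hpw.sampleProb_nonneg hpw.sum_sampleProb hpw.sum_sampleProb_smul_invLift
            (fun i => (MeanCoreset.norm_invLift _).le) k (by linarith [hε.1]) bad
            fun s hs => (Finset.mem_filter.1 hs).2
      _ ≤ δ := hkδ
  calc 1 - δ ≤ 1 - μ.real {ω | (fun j => S j ω) ∈ bad} := by linarith
    _ = μ.real {ω | (fun j => S j ω) ∈ bad}ᶜ := (probReal_compl_eq_one_sub hmeas).symm
    _ ≤ _ := by
        refine measureReal_mono fun ω hω x => hpw.abs_cost_sub_cost_le hk0 _ ?_ x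
        simpa [hbad] using hω
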